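/- Let $(\mathbb{E},\circ)$ be a finite-dimensional Euclidean Jordan algebra, i.e. a finite-dimensional real inner product space with a commutative bilinear product $\circ$ with identity $e$ such that $x\circ(x^2\circ y)=x^2\circ(x\circ y)$ and $\langle x\circ y,z\rangle=\langle y,x\circ z\rangle$. Let $\mathcal{K}=\{x\circ x: x\in\mathbb{E}\}$ be its symmetric cone. For an element $x=\sum_i\lambda_i c_i$ of a Euclidean Jordan algebra, decomposed spectrally along a Jordan frame $(c_i)$, put $\det(x)=\prod_i\lambda_i$, $\|x\|_\infty=\max_i|\lambda_i|$ and, if all $\lambda_i>0$, $x^{-1/2}=\sum_i\lambda_i^{-1/2}c_i$; let $Q_v(x)=2v\circ(v\circ x)-v^2\circ x$. Let $\mathcal{A}:\mathbb{E}\to\mathbb{R}^m$ be linear, $b\in\mathbb{R}^m$, $c\in\mathbb{E}$, and consider $$\text{(P)}\qquad \theta_p=\inf\{\langle c,x\rangle : \mathcal{A}x=b,\ x\in\mathcal{K}\}\in\mathbb{R}\cup\{\pm\infty\}.$$ An interior feasible solution of (P) is an $x\in\operatorname{int}\mathcal{K}$ with $\mathcal{A}x=b$; (P) is strongly feasible if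 one exists. For $\theta\in\mathbb{R}$ let $$\ker\mathcal{A}(\theta)=\{(x,\tau,\rho)\in\mathbb{E}\times\mathbb{R}^2:\ \mathcal{A}x-\tau b=0,\ \langle c,x\rangle-\theta\tau+\rho=0\},\qquad \bar{\mathcal{K}}=\mathcal{K}\times\mathbb{R}^2_+ ,$$ where $\mathbb{E}\times\mathbb{R}^2$ carries the componentwise Jordan product. For a linear subspace $\mathcal{L}\subseteq\mathbb{E}\times\mathbb{R}^2$ let $$\delta_\infty(\mathcal{L}\cap\operatorname{int}\bar{\mathcal{K}})=\max\{\det(z): z\in\mathcal{L}\cap\operatorname{int}\bar{\mathcal{K}},\ \|z\|_\infty=1\}.$$ **Proposition.** Suppose that (P) is strongly feasible, and that $\theta\in\mathbb{R}$ and an interior feasible solution $s$ of (P) satisfy $\max\{\theta_p,\theta-1\}<\langle c,s\rangle<\theta$. Let $v_s=(s^{-1/2},1,1)$, and let $(s_1,s_2,s_3)$ be a point that attains the maximum $\delta_\infty(Q_{v_s}(\ker\mathcal{A}(\theta))\cap\operatorname{int}\bar{\mathcal{K}})$. If $s_1=e$, then for every interior feasible solution $x$ of (P) with $\max\{\theta_p,\theta-1\}<\langle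 c,x\rangle<\langle c,s\rangle$, $$\delta_\infty(Q_{v_x}(\ker\mathcal{A}(\theta))\cap\operatorname{int}\bar{\mathcal{K}})>\delta_\infty(Q_{v_s}(\ker\mathcal{A}(\theta))\cap\operatorname{int}\bar{\mathcal{K}}),\qquad v_x=(x^{-1/2},1,1).$$ -/

import Mathlib

/-! ### Euclidean Jordan algebras -/

/-- A Euclidean Jordan algebra: a real inner product space with a commutative, unital, bilinear
product that satisfies the Jordan identity (`IsCommJordan`) and `⟪x ∘ y, z⟫ = ⟪y, x ∘ z⟫`.
The Jordan product `x ∘ y` is written `x * y` and the identity element `e` is written `1`.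
Finite dimensionality is a separate assumption `[FiniteDimensional ℝ E]`. -/
class EuclideanJordanAlgebra (E : Type*) [NormedAddCommGroup E] [InnerProductSpace ℝ E]
    extends CommMagma E, MulOneClass E, IsCommJordan E where
  add_mul_jordan : ∀ x y z : E, (x + y) * z = x * z + y * z
  smul_mul_jordan : ∀ (t : ℝ) (x y : E), (t • x) * y = t • (x * y)
  inner_mul_jordan : ∀ x y z : E, inner ℝ (x * y) z = inner ℝ y (x * z)

namespace JordanSCP

section Algebra

variable {A : Type*} [AddCommGroup A] [Module ℝ A] [Mul A] [One A]

/-- A nonzero idempotent that is not a sum of two nonzero idempotents. -/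
def IsPrimitiveIdempotent (c : A) : Prop :=
  IsIdempotentElem c ∧ c ≠ 0 ∧
    ∀ a b : A, IsIdempotentElem a → IsIdempotentElem b → a ≠ 0 → b ≠ 0 → c ≠ a + b

/-- A Jordan frame `c₁, …, cₙ`: primitive idempotents, pairwise orthogonal, with sum `e`. -/
structure IsJordanFrame {n : ℕ} (c : Fin n → A) : Prop where
  primitive : ∀ i, IsPrimitiveIdempotent (c i)
  orthogonal : ∀ i j, i ≠ j → c i * c j = 0
  sum_eq_one : ∑ i, c i = 1

/-- A spectral decomposition `x = ∑ λᵢ cᵢ` of `x` along a Jordan frame. -/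
structure SpectralDecomposition (x : A) where
  rank : ℕ
  eigenvalue : Fin rank → ℝ
  frame : Fin rank → A
  isJordanFrame : IsJordanFrame frame
  eq_sum : x = ∑ i, eigenvalue i • frame i

open Classical in
/-- The eigenvalues of `x`, with multiplicities. In a Euclidean Jordan algebra every element has a
spectral decomposition, and all of them give the same multiset, so that the choice is immaterial. -/
noncomputable def eigenvalues (x : A) : Multiset ℝ :=
  if h : Nonempty (SpectralDecomposition x) then
    (Finset.univ.val : Multiset (Fin h.some.rank)).map h.some.eigenvalue
  else 0

/-- `det x = ∏ λᵢ`. -/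
noncomputable def det (x : A) : ℝ := (eigenvalues x).prod

/-- `‖x‖_∞ = max |λᵢ|`. -/
noncomputable def infNorm (x : A) : ℝ := sSup {t : ℝ | ∃ l ∈ eigenvalues x, t = |l|}

open Classical in
/-- `x^{-1/2} = ∑ λᵢ^{-1/2} cᵢ` for `x = ∑ λᵢ cᵢ` with positive eigenvalues; again the result does
not depend on the spectral decomposition. -/
noncomputable def invSqrt (x : A) : A :=
  if h : Nonempty (SpectralDecomposition x) then
    ∑ i, (Real.sqrt (h.some.eigenvalue i))⁻¹ • h.some.frame i
  else 0

/-- The quadratic representation `Q_v(x) = 2 v ∘ (v ∘ x) - v² ∘ x`. -/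
def quadRep (v x : A) : A := (2 : ℝ) • (v * (v * x)) - (v * v) * x

/-- `δ_∞(S) = max {det x | x ∈ S, ‖x‖_∞ = 1}`. The set of values is bounded above by `1`; for
`S = L ∩ int K` nonempty, with `L` a subspace, the supremum is attained. -/
noncomputable def deltaInf (S : Set A) : ℝ := sSup (det '' {x ∈ S | infNorm x = 1})

/-- `y` is a point that gives the maximum value `δ_∞(S)`. -/
def IsDeltaMaximizer (S : Set A) (y : A) : Prop :=
  (y ∈ S ∧ infNorm y = 1) ∧ ∀ z ∈ S, infNorm z = 1 → det z ≤ det y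

end Algebra

section Program

variable {E : Type*} [NormedAddCommGroup E] [InnerProductSpace ℝ E] [EuclideanJordanAlgebra E]

variable (E) in
/-- The symmetric cone `K = {x ∘ x | x ∈ E}`. -/
def symCone : Set E := {x | ∃ y : E, x = y * y}

variable (E) in
/-- The cone `K × ℝ²₊` in the product algebra `E × ℝ × ℝ`. -/
def symConeBar : Set (E × ℝ × ℝ) := symCone E ×ˢ (Set.Ici (0 : ℝ) ×ˢ Set.Ici (0 : ℝ))

variable {m : ℕ}

/-- `x` is an interior feasible solution of (P): `inf ⟪c, x⟫` subject to `𝒜 x = b`, `x ∈ K`. -/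
def IsInteriorFeasible (𝒜 : E →ₗ[ℝ] (Fin m → ℝ)) (b : Fin m → ℝ) (x : E) : Prop :=
  x ∈ interior (symCone E) ∧ 𝒜 x = b

/-- (P) has an interior feasible solution. -/
def StronglyFeasible (𝒜 : E →ₗ[ℝ] (Fin m → ℝ)) (b : Fin m → ℝ) : Prop :=
  ∃ x : E, IsInteriorFeasible 𝒜 b x

/-- The optimal value `θ_p` of (P) in `ℝ ∪ {±∞}` (equal to `+∞` if (P) is infeasible). -/
noncomputable def primalValue (𝒜 : E →ₗ[ℝ] (Fin m → ℝ)) (b : Fin m → ℝ) (c : E) : EReal :=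
  sInf {t : EReal | ∃ x ∈ symCone E, 𝒜 x = b ∧ t = ((inner ℝ c x : ℝ) : EReal)}

/-- The kernel of `𝒜(θ) : (x, τ, ρ) ↦ (𝒜 x - τ b, ⟪c, x⟫ - θ τ + ρ)`. -/
def kerTheta (𝒜 : E →ₗ[ℝ] (Fin m → ℝ)) (b : Fin m → ℝ) (c : E) (θ : ℝ) : Set (E × ℝ × ℝ) :=
  {p | 𝒜 p.1 - p.2.1 • b = 0 ∧ inner ℝ c p.1 - θ * p.2.1 + p.2.2 = 0}

/-- `Q_v(ker 𝒜(θ)) ∩ int (K × ℝ²₊)`. -/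
def scaledSet (𝒜 : E →ₗ[ℝ] (Fin m → ℝ)) (b : Fin m → ℝ) (c : E) (θ : ℝ) (v : E × ℝ × ℝ) :
    Set (E × ℝ × ℝ) :=
  (quadRep v '' kerTheta 𝒜 b c θ) ∩ interior (symConeBar E)

/-- The scaling point `v_x = (x^{-1/2}, 1, 1)`. -/
noncomputable def scalingPoint (x : E) : E × ℝ × ℝ := (invSqrt x, 1, 1)

end Program

end JordanSCP

/-! Since `Q_{x^{-1/2}}` is injective and sends `x` to `e`, the points of the scaled set at `x` with
first component `e` are exactly the `(e, t, r)` with `t • b = b`, `r = θ t - ⟪c, x⟫`, `t, r > 0`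
(and `e` interior to the cone); see `one_mem_scaledSet_iff`. Such a point has determinant `t r`, and
norm `1` iff `t, r ≤ 1`.

The maximizer at `s` is such a point `(e, t, r)`, so it suffices to exhibit a better one at `x`.
Keeping `t` raises the last coordinate to `r' = θ t - ⟪c, x⟫ > r`, which settles the case `r' ≤ 1`.
If `r' > 1`, then `⟪c, x⟫ > θ - 1` excludes `t = 1`, so `b = 0` and `t` may vary; moreover `θ < 0`,
and raising `t` until the last coordinate drops to `1` gives a larger product.

Most of the work is algebraic. The spectral theorem `nonempty_spectralDecomposition` shows that the
chosen decompositions behind `eigenvalues` and `invSqrt` exist. Injectivity of `Q_{x^{-1/2}}` is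
positivity of its quadratic form (`IsIdempotentDecomposition.eq_zero_of_quadRep_eq_zero`).
Uniqueness of eigenvalues is needed only at `(e, t, r)`, where `eigenvalues_one_prod` reads them off
from an arbitrary Jordan frame. -/

namespace JordanSCP

/-! ### Multiplication operators and power associativity. -/

section Operators

variable {E : Type*} [NormedAddCommGroup E] [InnerProductSpace ℝ E] [EuclideanJordanAlgebra E]

/-- The distributive ring structure underlying a Euclidean Jordan algebra. -/
scoped instance instNonUnitalNonAssocCommRing : NonUnitalNonAssocCommRing E where
  left_distrib a b c := by
    rw [mul_comm a, EuclideanJordanAlgebra.add_mul_jordan, mul_comm b, mul_comm c]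
  right_distrib := EuclideanJordanAlgebra.add_mul_jordan
  zero_mul a := by
    have h := EuclideanJordanAlgebra.add_mul_jordan (0 : E) 0 a
    rw [add_zero] at h
    exact left_eq_add.mp h
  mul_zero a := by
    have h := EuclideanJordanAlgebra.add_mul_jordan (0 : E) 0 a
    rw [add_zero] at h
    rw [mul_comm]
    exact left_eq_add.mp h
  mul_comm := mul_comm

scoped instance instIsScalarTower : IsScalarTower ℝ E E where
  smul_assoc t x y := EuclideanJordanAlgebra.smul_mul_jordan t x y

scoped instance instSMulCommClass : SMulCommClass ℝ E E where
  smul_comm t x y := by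
    change t • (x * y) = x * (t • y)
    rw [mul_comm x (t • y), EuclideanJordanAlgebra.smul_mul_jordan, mul_comm]

/-- The fully linearised Jordan identity. -/
theorem jordan_linearized (x y z u : E) :
    x * ((y * z) * u) + y * ((z * x) * u) + z * ((x * y) * u)
      = (y * z) * (x * u) + (z * x) * (y * u) + (x * y) * (z * u) := by
  have h := DFunLike.congr_fun (two_nsmul_lie_lmul_lmul_add_add_eq_zero x y z) u
  simp only [Ring.lie_def] at h
  change 2 • (x * ((y * z) * u) - (y * z) * (x * u) + (y * ((z * x) * u) - (z * x) * (y * u))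
    + (z * ((x * y) * u) - (x * y) * (z * u))) = 0 at h
  have h2 := (smul_eq_zero_iff_right (M := E) (two_ne_zero : (2 : ℝ) ≠ 0)).mp
    (by rw [two_smul, ← two_nsmul]; exact h)
  rw [← sub_eq_zero, ← h2]
  abel

/-- The Jordan multiplication operator `L_x`. -/
abbrev lmul (x : E) : Module.End ℝ E := LinearMap.mulLeft ℝ x

theorem inner_lmul_left (x u v : E) : inner ℝ (x * u) v = inner ℝ u (x * v) :=
  EuclideanJordanAlgebra.inner_mul_jordan x u v

theorem lmul_isSymmetric (x : E) : (lmul x).IsSymmetric := fun u v => inner_lmul_left x u v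

theorem commute_lmul_sq (x : E) : Commute (lmul x) (lmul (x * x)) := by
  refine LinearMap.ext fun u => ?_
  change x * ((x * x) * u) = (x * x) * (x * u)
  have h := IsCommJordan.lmul_comm_rmul_rmul x u
  rw [mul_comm (x * x) u, mul_comm (x * x) (x * u), h]

/-- The linearised Jordan identity, read as an operator identity in one of its variables. With `y` a
power of `x` it becomes a two-term recursion for the operators of the powers. -/
theorem lmul_mul_mul (x y : E) :
    lmul (x * (x * y)) = lmul (x * y) * lmul x + lmul (x * x) * lmul y + lmul (x * y) * lmul x
      - lmul x * lmul x * lmul y - lmul y * (lmul x * lmul x) := by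
  refine LinearMap.ext fun u => ?_
  have h := jordan_linearized u x y x
  change (x * (x * y)) * u = (x * y) * (x * u) + (x * x) * (y * u) + (x * y) * (x * u)
    - x * (x * (y * u)) - y * (x * (x * u))
  rw [mul_comm x (x * y), mul_comm _ u]
  have e1 : y * u * x = x * (y * u) := mul_comm _ _
  have e2 : u * x * x = x * (x * u) := by rw [mul_comm u x, mul_comm]
  have e3 : y * u * (x * x) = x * x * (y * u) := mul_comm _ _
  have e4 : u * x * (y * x) = x * y * (x * u) := by rw [mul_comm u x, mul_comm y x, mul_comm]
  have e5 : x * y * (u * x) = x * y * (x * u) := by rw [mul_comm u x]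
  rw [e1, e2, e3, e4, e5] at h
  rw [eq_sub_iff_add_eq, eq_sub_iff_add_eq]
  rw [← h]
  abel

theorem commute_lmul_pow (x : E) (n : ℕ) :
    Commute (lmul x) (lmul ((lmul x ^ n) 1)) ∧ Commute (lmul (x * x)) (lmul ((lmul x ^ n) 1)) := by
  have hs := commute_lmul_sq x
  -- The recursion reaches back two powers, so the induction carries two consecutive exponents.
  have key : ∀ n, (Commute (lmul x) (lmul ((lmul x ^ n) 1)) ∧
      Commute (lmul (x * x)) (lmul ((lmul x ^ n) 1))) ∧
      (Commute (lmul x) (lmul ((lmul x ^ (n + 1)) 1)) ∧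
      Commute (lmul (x * x)) (lmul ((lmul x ^ (n + 1)) 1))) := by
    intro n
    induction n with
    | zero =>
      have h1 : lmul (1 : E) = 1 := LinearMap.ext fun u => one_mul u
      have h2 : lmul x (1 : E) = x := mul_one x
      simp only [pow_zero, Module.End.one_apply, h1, zero_add, pow_one, h2]
      exact ⟨⟨Commute.one_right _, Commute.one_right _⟩, Commute.refl _, hs.symm⟩
    | succ n ih =>
      refine ⟨ih.2, ?_⟩
      obtain ⟨⟨a1, a2⟩, b1, b2⟩ := ih
      have hy : (lmul x ^ (n + 1)) 1 = x * (lmul x ^ n) 1 := by rw [pow_succ']; rfl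
      have hz : (lmul x ^ (n + 1 + 1)) 1 = x * (x * (lmul x ^ n) 1) := by
        rw [pow_succ', pow_succ']; rfl
      rw [hy] at b1 b2
      rw [hz, lmul_mul_mul]
      have hx := Commute.refl (lmul x)
      have hxx := Commute.refl (lmul (x * x))
      have hs' := hs.symm
      exact ⟨((((b1.mul_right hx).add_right (hs.mul_right a1)).add_right (b1.mul_right hx)).sub_right
          ((hx.mul_right hx).mul_right a1)).sub_right (a1.mul_right (hx.mul_right hx)),
        ((((b2.mul_right hs').add_right (hxx.mul_right a2)).add_right (b2.mul_right hs')).sub_right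
          ((hs'.mul_right hs').mul_right a2)).sub_right (a2.mul_right (hs'.mul_right hs'))⟩
  exact (key n).1

/-- The value `p(x)` of a polynomial at an element of a Jordan algebra. -/
noncomputable def polyEval (x : E) (p : Polynomial ℝ) : E := Polynomial.aeval (lmul x) p 1

theorem commute_lmul_polyEval (x : E) (p : Polynomial ℝ) :
    Commute (lmul x) (lmul (polyEval x p)) := by
  induction p using Polynomial.induction_on' with
  | add p q hp hq =>
    have : lmul (polyEval x (p + q)) = lmul (polyEval x p) + lmul (polyEval x q) := by
      refine LinearMap.ext fun u => ?_
      simp [polyEval, add_mul]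
    rw [this]
    exact hp.add_right hq
  | monomial n a =>
    have : lmul (polyEval x (Polynomial.monomial n a)) = a • lmul ((lmul x ^ n) 1) := by
      refine LinearMap.ext fun u => ?_
      simp [polyEval, Polynomial.aeval_monomial, smul_mul_assoc, Algebra.algebraMap_eq_smul_one]
    rw [this]
    exact (commute_lmul_pow x n).1.smul_right a

/-- `q(L_x)` is a polynomial in `L_x`, hence commutes with multiplication by `p(x)`; evaluating both
orders at `1` gives the product rule. -/
theorem polyEval_mul (x : E) (p q : Polynomial ℝ) :
    polyEval x p * polyEval x q = polyEval x (p * q) := by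
  have h : Commute (Polynomial.aeval (lmul x) q) (lmul (polyEval x p)) :=
    Algebra.commute_of_mem_adjoin_singleton_of_commute
      (Polynomial.aeval_mem_adjoin_singleton ℝ (lmul x)) (commute_lmul_polyEval x p).symm |>.symm
  have h1 := DFunLike.congr_fun h.eq (1 : E)
  change Polynomial.aeval (lmul x) q (polyEval x p * 1) = polyEval x p * polyEval x q at h1
  rw [← h1, mul_one, mul_comm p q, polyEval, polyEval, map_mul]
  rfl

/-- The Peirce relation `2 L³ = 3 L² - L` for the multiplication operator of an idempotent. -/
theorem idempotent_cubic {a : E} (ha : IsIdempotentElem a) (u : E) :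
    (2 : ℝ) • (a * (a * (a * u))) = (3 : ℝ) • (a * (a * u)) - a * u := by
  have h := jordan_linearized u a a a
  rw [ha.eq, ha.eq, mul_comm u a] at h
  rw [mul_comm (a * u) a] at h
  rw [eq_sub_iff_add_eq, two_smul, show (3 : ℝ) = 1 + 1 + 1 by norm_num, add_smul, add_smul,
    one_smul, ← h]
  abel

end Operators

/-! ### Idempotents and the spectral theorem. -/

section Spectral

variable {E : Type*} [NormedAddCommGroup E] [InnerProductSpace ℝ E] [EuclideanJordanAlgebra E]

/-- By the cubic relation `L = L² + 4 (L - L²)²`, and `L` is self-adjoint. -/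
theorem inner_idempotent_mul_self {a : E} (ha : IsIdempotentElem a) (u : E) :
    inner ℝ (a * u) u = ‖a * u‖ ^ 2 + 4 * ‖a * u - a * (a * u)‖ ^ 2 := by
  have h := congrArg (fun w => inner ℝ w u) (idempotent_cubic ha u)
  have h2 := congrArg (fun w => inner ℝ w (a * u)) (idempotent_cubic ha u)
  simp only [inner_smul_left, inner_sub_left, inner_lmul_left] at h h2
  simp only [← real_inner_self_eq_norm_sq, inner_sub_left, inner_sub_right, inner_lmul_left]
  simp only [map_ofNat] at h h2
  linarith

theorem inner_idempotent_mul_self_nonneg {a : E} (ha : IsIdempotentElem a) (u : E) :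
    0 ≤ inner ℝ (a * u) u := by
  rw [inner_idempotent_mul_self ha]
  positivity

theorem idempotent_mul_eq_zero {a : E} (ha : IsIdempotentElem a) {u : E}
    (h : inner ℝ (a * u) u = 0) : a * u = 0 := by
  rw [inner_idempotent_mul_self ha] at h
  have : ‖a * u‖ ^ 2 = 0 := by nlinarith [sq_nonneg ‖a * u‖, sq_nonneg ‖a * u - a * (a * u)‖]
  simpa using this

theorem inner_mul_one (a b : E) : inner ℝ (a * b) 1 = inner ℝ a b := by
  rw [mul_comm, inner_lmul_left, mul_one]

theorem inner_idempotents_nonneg {a f : E} (ha : IsIdempotentElem a) (hf : IsIdempotentElem f) :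
    0 ≤ inner ℝ a f := by
  have := inner_idempotent_mul_self_nonneg hf a
  rwa [mul_comm, inner_lmul_left, ha.eq, real_inner_comm] at this

/-- A family of nonzero pairwise orthogonal idempotents with sum `1` that diagonalises `x`. -/
structure IsIdempotentDecomposition {ι : Type*} [Fintype ι] (x : E) (l : ι → ℝ) (c : ι → E) :
    Prop where
  idem : ∀ i, IsIdempotentElem (c i)
  ne_zero : ∀ i, c i ≠ 0
  orthogonal : ∀ i j, i ≠ j → c i * c j = 0
  sum_eq_one : ∑ i, c i = 1
  eq_sum : x = ∑ i, l i • c i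

theorem aeval_eq_of_eval_eigenvalues_eq [FiniteDimensional ℝ E] {T : Module.End ℝ E}
    (hT : T.IsSymmetric) {p q : Polynomial ℝ}
    (h : ∀ i, p.eval (hT.eigenvalues rfl i) = q.eval (hT.eigenvalues rfl i)) :
    Polynomial.aeval T p = Polynomial.aeval T q := by
  refine (hT.eigenvectorBasis rfl).toBasis.ext fun i => ?_
  rw [OrthonormalBasis.coe_toBasis,
    Module.End.aeval_apply_of_hasEigenvector (hT.hasEigenvector_eigenvectorBasis rfl i),
    Module.End.aeval_apply_of_hasEigenvector (hT.hasEigenvector_eigenvectorBasis rfl i)]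
  exact congrArg (· • _) (h i)

theorem IsIdempotentDecomposition.reindex {ι κ : Type*} [Fintype ι] [Fintype κ] {x : E}
    {l : ι → ℝ} {c : ι → E} (h : IsIdempotentDecomposition x l c) (e : κ ≃ ι) :
    IsIdempotentDecomposition x (l ∘ e) (c ∘ e) where
  idem i := h.idem _
  ne_zero i := h.ne_zero _
  orthogonal i j hij := h.orthogonal _ _ (e.injective.ne hij)
  sum_eq_one := by rw [← h.sum_eq_one]; exact e.sum_comp c
  eq_sum := by rw [h.eq_sum]; exact (e.sum_comp fun i => l i • c i).symm

/-- `L_x` is self-adjoint, so Lagrange basis polynomials at its eigenvalues, evaluated at `x`,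
behave like indicator functions: they give orthogonal idempotents. -/
theorem exists_idempotentDecomposition [FiniteDimensional ℝ E] (x : E) :
    ∃ (n : ℕ) (l : Fin n → ℝ) (c : Fin n → E), IsIdempotentDecomposition x l c := by
  classical
  have hT := lmul_isSymmetric x
  let R : Finset ℝ := Finset.univ.image (hT.eigenvalues rfl)
  let P : ℝ → Polynomial ℝ := fun t => Lagrange.basis R id t
  have hP : ∀ t ∈ R, ∀ i, (P t).eval (hT.eigenvalues rfl i)
      = if hT.eigenvalues rfl i = t then 1 else 0 := by
    intro t ht i
    have hi : hT.eigenvalues rfl i ∈ R := Finset.mem_image_of_mem _ (Finset.mem_univ i)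
    split_ifs with heq
    · rw [heq]
      exact Lagrange.eval_basis_self (v := id) (fun _ _ _ _ h => h) ht
    · exact Lagrange.eval_basis_of_ne (v := id) (Ne.symm heq) hi
  have hext : ∀ p q : Polynomial ℝ,
      (∀ i, p.eval (hT.eigenvalues rfl i) = q.eval (hT.eigenvalues rfl i)) →
      polyEval x p = polyEval x q := fun p q h =>
    DFunLike.congr_fun (aeval_eq_of_eval_eigenvalues_eq hT h) 1
  have hsum : ∀ f : ℝ → ℝ, ∑ t ∈ R, f t • polyEval x (P t)
      = polyEval x (∑ t ∈ R, Polynomial.C (f t) * P t) := by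
    intro f
    simp [polyEval, Algebra.algebraMap_eq_smul_one]
  have heval : ∀ (f : ℝ → ℝ) i, (∑ t ∈ R, Polynomial.C (f t) * P t).eval (hT.eigenvalues rfl i)
      = f (hT.eigenvalues rfl i) := by
    intro f i
    have hi : hT.eigenvalues rfl i ∈ R := Finset.mem_image_of_mem _ (Finset.mem_univ i)
    rw [Polynomial.eval_finsetSum, Finset.sum_congr rfl fun t ht => by
      rw [Polynomial.eval_mul, Polynomial.eval_C, hP t ht i]]
    simp [hi]
  -- Eigenvalues of `L_x` need not be eigenvalues of `x` (half-sums of these also occur); the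
  -- superfluous ones yield the zero idempotent.
  let S : Finset ℝ := R.filter fun t => polyEval x (P t) ≠ 0
  have hS : ∀ f : ℝ → ℝ, ∑ t : S, f t • polyEval x (P t) = ∑ t ∈ R, f t • polyEval x (P t) := by
    intro f
    rw [Finset.sum_coe_sort S fun t => f t • polyEval x (P t), Finset.sum_filter_of_ne]
    intro t _ h h0
    exact h (by rw [h0, smul_zero])
  have hdec : IsIdempotentDecomposition x (fun t : S => (t : ℝ)) fun t : S => polyEval x (P t) := by
    refine ⟨fun t => ?_, fun t => (Finset.mem_filter.mp t.2).2, fun t u htu => ?_, ?_, ?_⟩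
    · have ht := (Finset.mem_filter.mp t.2).1
      rw [IsIdempotentElem, polyEval_mul]
      refine hext _ _ fun i => ?_
      rw [Polynomial.eval_mul, hP _ ht]
      split_ifs <;> simp
    · have ht := (Finset.mem_filter.mp t.2).1
      have hu := (Finset.mem_filter.mp u.2).1
      have h0 : polyEval x (0 : Polynomial ℝ) = 0 := by simp [polyEval]
      rw [polyEval_mul, ← h0]
      refine hext _ _ fun i => ?_
      rw [Polynomial.eval_mul, hP _ ht, hP _ hu, Polynomial.eval_zero]
      split_ifs with h1 h2
      · exact absurd (Subtype.ext (h1.symm.trans h2)) htu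
      all_goals simp
    · have h := hS fun _ => 1
      rw [hsum, hext _ 1 fun i => by rw [heval]; simp] at h
      simpa [polyEval] using h
    · have h := hS fun t => t
      rw [hsum, hext _ Polynomial.X fun i => by rw [heval]; simp] at h
      rw [h]
      simp [polyEval]
  exact ⟨_, _, _, hdec.reindex S.equivFin.symm⟩

theorem IsIdempotentDecomposition.card_le_finrank [FiniteDimensional ℝ E] {n : ℕ} {x : E}
    {l : Fin n → ℝ} {c : Fin n → E} (h : IsIdempotentDecomposition x l c) :
    n ≤ Module.finrank ℝ E := by
  have hli : LinearIndependent ℝ c :=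
    linearIndependent_of_ne_zero_of_inner_eq_zero (𝕜 := ℝ) h.ne_zero fun i j hij => by
      change inner ℝ (c i) (c j) = 0
      rw [← inner_mul_one, h.orthogonal i j hij, inner_zero_left]
  simpa using hli.fintype_card_le_finrank

theorem mul_eq_zero_of_idempotent_add {a b : E} (ha : IsIdempotentElem a)
    (hb : IsIdempotentElem b) (hab : IsIdempotentElem (a + b)) : a * b = 0 := by
  have h := hab.eq
  rw [add_mul, mul_add, mul_add, ha.eq, hb.eq, mul_comm b a] at h
  have h2 : (2 : ℝ) • (a * b) = 0 := by
    rw [two_smul, ← sub_eq_zero.mpr h]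
    abel
  exact (smul_eq_zero_iff_right (two_ne_zero : (2 : ℝ) ≠ 0)).mp h2

/-- Idempotents have nonnegative inner products, so `⟪a, f⟫ + ⟪b, f⟫ = 0` kills both terms. This
keeps the pieces orthogonal to the other members when one member of a family is split. -/
theorem mul_eq_zero_of_add_mul_eq_zero {a b f : E} (ha : IsIdempotentElem a)
    (hb : IsIdempotentElem b) (hf : IsIdempotentElem f) (h : (a + b) * f = 0) : a * f = 0 := by
  have h1 := inner_idempotents_nonneg ha hf
  have h2 := inner_idempotents_nonneg hb hf
  have h3 : inner ℝ a f + inner ℝ b f = 0 := by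
    rw [← inner_add_left, ← inner_mul_one, h, inner_zero_left]
  rw [mul_comm]
  refine idempotent_mul_eq_zero hf ?_
  rw [mul_comm, inner_lmul_left, ha.eq, real_inner_comm]
  linarith

theorem IsIdempotentDecomposition.split {n : ℕ} {x : E} {l : Fin n → ℝ} {c : Fin n → E}
    (h : IsIdempotentDecomposition x l c) {i : Fin n} {a b : E} (ha : IsIdempotentElem a)
    (hb : IsIdempotentElem b) (ha0 : a ≠ 0) (hb0 : b ≠ 0) (hab : c i = a + b) :
    IsIdempotentDecomposition x (Fin.cons (l i) l) (Fin.cons b (Function.update c i a)) := by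
  have hab0 : a * b = 0 := mul_eq_zero_of_idempotent_add ha hb (hab ▸ h.idem i)
  have haj : ∀ j, j ≠ i → a * c j = 0 := fun j hj =>
    mul_eq_zero_of_add_mul_eq_zero ha hb (h.idem j) (hab ▸ h.orthogonal i j hj.symm)
  have hbj : ∀ j, j ≠ i → b * c j = 0 := fun j hj =>
    mul_eq_zero_of_add_mul_eq_zero hb ha (h.idem j)
      (add_comm a b ▸ hab ▸ h.orthogonal i j hj.symm)
  have hbu : ∀ j, b * Function.update c i a j = 0 := by
    intro j
    by_cases hj : j = i
    · subst hj; rw [Function.update_self, mul_comm, hab0]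
    · rw [Function.update_of_ne hj, hbj j hj]
  have hsum : ∀ f : Fin n → ℝ, f i • b + ∑ j, f j • Function.update c i a j = ∑ j, f j • c j := by
    intro f
    rw [← Finset.add_sum_erase _ _ (Finset.mem_univ i),
      ← Finset.add_sum_erase _ (fun j => f j • c j) (Finset.mem_univ i), Function.update_self, hab,
      smul_add, ← add_assoc, add_comm (f i • b)]
    congr 1
    refine Finset.sum_congr rfl fun j hj => ?_
    rw [Function.update_of_ne (Finset.ne_of_mem_erase hj)]
  constructor
  · refine Fin.cases hb fun j => ?_
    rw [Fin.cons_succ]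
    by_cases hj : j = i
    · subst hj; rwa [Function.update_self]
    · rw [Function.update_of_ne hj]; exact h.idem j
  · refine Fin.cases hb0 fun j => ?_
    rw [Fin.cons_succ]
    by_cases hj : j = i
    · subst hj; rwa [Function.update_self]
    · rw [Function.update_of_ne hj]; exact h.ne_zero j
  · intro j k
    refine Fin.cases ?_ (fun j => ?_) j <;> refine Fin.cases ?_ (fun k => ?_) k
    · exact fun h => absurd rfl h
    · exact fun _ => hbu k
    · intro _; rw [mul_comm]; exact hbu j
    intro hjk
    have hjk' : j ≠ k := fun h => hjk (h ▸ rfl)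
    rw [Fin.cons_succ, Fin.cons_succ]
    by_cases hj : j = i
    · subst hj
      rw [Function.update_self, Function.update_of_ne hjk'.symm, haj k hjk'.symm]
    · by_cases hk : k = i
      · subst hk
        rw [Function.update_self, Function.update_of_ne hj, mul_comm, haj j hj]
      · rw [Function.update_of_ne hj, Function.update_of_ne hk, h.orthogonal j k hjk']
  · have := hsum fun _ => 1
    simp only [one_smul] at this
    rw [Fin.sum_univ_succ]
    exact this.trans h.sum_eq_one
  · rw [Fin.sum_univ_succ]
    exact h.eq_sum.trans (hsum l).symm

/-- Spectral theorem for Euclidean Jordan algebras. -/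
theorem nonempty_spectralDecomposition [FiniteDimensional ℝ E] (x : E) :
    Nonempty (SpectralDecomposition x) := by
  by_contra hx
  -- Without a Jordan frame, some member is never primitive and can be split; the growing families
  -- eventually exceed the dimension.
  have step : ∀ n, (∃ (l : Fin n → ℝ) (c : Fin n → E), IsIdempotentDecomposition x l c) →
      ∃ (l : Fin (n + 1) → ℝ) (c : Fin (n + 1) → E), IsIdempotentDecomposition x l c := by
    rintro n ⟨l, c, h⟩
    by_cases hp : ∀ i, IsPrimitiveIdempotent (c i)
    · exact absurd ⟨⟨n, l, c, ⟨hp, h.orthogonal, h.sum_eq_one⟩, h.eq_sum⟩⟩ hx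
    · simp only [IsPrimitiveIdempotent] at hp
      push Not at hp
      obtain ⟨i, hi⟩ := hp
      obtain ⟨a, b, ha, hb, ha0, hb0, hab⟩ := hi (h.idem i) (h.ne_zero i)
      exact ⟨_, _, h.split ha hb ha0 hb0 hab⟩
  obtain ⟨n, h0⟩ := exists_idempotentDecomposition x
  have hall : ∀ k, ∃ (l : Fin (n + k) → ℝ) (c : Fin (n + k) → E),
      IsIdempotentDecomposition x l c := by
    intro k
    induction k with
    | zero => exact h0
    | succ k ih => exact step _ ih
  obtain ⟨l, c, h⟩ := hall (Module.finrank ℝ E + 1)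
  have := h.card_le_finrank
  omega

end Spectral

/-! ### Injectivity of the quadratic representation. -/

section QuadraticRepresentation

variable {E : Type*} [NormedAddCommGroup E] [InnerProductSpace ℝ E] [EuclideanJordanAlgebra E]

theorem orthogonal_idempotents_comm {a b : E} (ha : IsIdempotentElem a) (hab : a * b = 0) (u : E) :
    a * (b * u) = b * (a * u) := by
  have h := jordan_linearized a a b u
  simp only [mul_comm b a, hab, ha.eq, zero_mul, mul_zero, zero_add] at h
  exact h.symm

/-- `L_a` and `L_b` commute, so `L_a = L_a² + 4 (L_a - L_a²)²` turns the form into two values of the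
nonnegative form of `L_b`. -/
theorem inner_orthogonal_idempotents_nonneg {a b : E} (ha : IsIdempotentElem a)
    (hb : IsIdempotentElem b) (hab : a * b = 0) (u : E) : 0 ≤ inner ℝ (a * (b * u)) u := by
  have key : inner ℝ (a * (b * u)) u = inner ℝ (b * (a * u)) (a * u)
      + 4 * inner ℝ (b * (a * u - a * (a * u))) (a * u - a * (a * u)) := by
    have h := congrArg (fun w => inner ℝ w u) (idempotent_cubic ha (b * u))
    have h2 := congrArg (fun w => inner ℝ w (a * u)) (idempotent_cubic ha (b * u))
    have hc := orthogonal_idempotents_comm ha hab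
    rw [mul_sub, ← hc, ← hc, ← hc]
    simp only [inner_smul_left, inner_sub_left, inner_sub_right, inner_lmul_left] at h h2 ⊢
    simp only [map_ofNat] at h h2
    linarith
  rw [key]
  have h1 := inner_idempotent_mul_self_nonneg hb (a * u)
  have h2 := inner_idempotent_mul_self_nonneg hb (a * u - a * (a * u))
  positivity

/-- The cubic relation makes `2 L² - L` a self-adjoint projection. -/
theorem inner_quadRep_idempotent_nonneg {a : E} (ha : IsIdempotentElem a) (u : E) :
    0 ≤ inner ℝ ((2 : ℝ) • (a * (a * u)) - a * u) u := by
  have key : inner ℝ ((2 : ℝ) • (a * (a * u)) - a * u) u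
      = inner ℝ ((2 : ℝ) • (a * (a * u)) - a * u) ((2 : ℝ) • (a * (a * u)) - a * u) := by
    have h := congrArg (fun w => inner ℝ w u) (idempotent_cubic ha u)
    have h2 := congrArg (fun w => inner ℝ w (a * u)) (idempotent_cubic ha u)
    simp only [inner_smul_left, inner_smul_right, inner_sub_left, inner_sub_right,
      inner_lmul_left] at h h2 ⊢
    simp only [map_ofNat] at h h2 ⊢
    linarith
  rw [key]
  exact real_inner_self_nonneg

variable {ι : Type*} [Fintype ι] {x : E} {l : ι → ℝ} {c : ι → E}

theorem IsIdempotentDecomposition.sum_smul_mul_sum_smul (h : IsIdempotentDecomposition x l c)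
    (f g : ι → ℝ) : (∑ i, f i • c i) * (∑ i, g i • c i) = ∑ i, (f i * g i) • c i := by
  classical
  rw [Finset.sum_mul_sum]
  refine Finset.sum_congr rfl fun i _ => ?_
  rw [Finset.sum_eq_single i]
  · rw [smul_mul_smul_comm, (h.idem i).eq]
  · intro j _ hj
    rw [smul_mul_smul_comm, h.orthogonal i j hj.symm, smul_zero]
  · simp

theorem IsIdempotentDecomposition.quadRep_sum_smul [DecidableEq ι]
    (h : IsIdempotentDecomposition x l c) (f : ι → ℝ) (d : E) :
    quadRep (∑ i, f i • c i) d = ∑ i, ∑ j, (f i * f j) •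
      ((2 : ℝ) • (c i * (c j * d)) - if i = j then c i * d else 0) := by
  rw [quadRep, h.sum_smul_mul_sum_smul]
  simp only [smul_sub, Finset.sum_sub_distrib, smul_ite, smul_zero, Finset.sum_ite_eq,
    Finset.mem_univ, if_true]
  congr 1
  · simp only [Finset.sum_mul, Finset.mul_sum, Finset.smul_sum, smul_mul_assoc, mul_smul_comm,
      smul_smul]
    rw [Finset.sum_comm]
    refine Finset.sum_congr rfl fun i _ => Finset.sum_congr rfl fun j _ => ?_
    congr 1
    ring
  · simp only [Finset.sum_mul, smul_mul_assoc]

/-- The form is `∑ fᵢ fⱼ Gᵢⱼ` with `Gᵢⱼ ≥ 0` independent of `f`. Vanishing for one positive `f`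
forces every `Gᵢⱼ = 0`; then `f = 1`, where `Q_e` is the identity, gives `‖d‖² = 0`. -/
theorem IsIdempotentDecomposition.eq_zero_of_quadRep_eq_zero
    (h : IsIdempotentDecomposition x l c) {f : ι → ℝ} (hf : ∀ i, 0 < f i) {d : E}
    (hd : quadRep (∑ i, f i • c i) d = 0) : d = 0 := by
  classical
  let G : ι → ι → ℝ := fun i j =>
    inner ℝ ((2 : ℝ) • (c i * (c j * d)) - if i = j then c i * d else 0) d
  have hG : ∀ i j, 0 ≤ G i j := by
    intro i j
    by_cases hij : i = j
    · subst hij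
      simpa [G] using inner_quadRep_idempotent_nonneg (h.idem i) d
    · simp only [G, if_neg hij, sub_zero, inner_smul_left]
      have := inner_orthogonal_idempotents_nonneg (h.idem i) (h.idem j) (h.orthogonal i j hij) d
      simpa using this
  have hsum : ∀ g : ι → ℝ, inner ℝ (quadRep (∑ i, g i • c i) d) d
      = ∑ i, ∑ j, g i * g j * G i j := by
    intro g
    simp only [h.quadRep_sum_smul, sum_inner, real_inner_smul_left, G]
  have h0 := hsum f
  rw [hd, inner_zero_left] at h0
  have hnn : ∀ i j, 0 ≤ f i * f j * G i j := fun i j =>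
    mul_nonneg (mul_pos (hf i) (hf j)).le (hG i j)
  have hz : ∀ i j, G i j = 0 := by
    intro i j
    have h1 := (Finset.sum_eq_zero_iff_of_nonneg
      fun i _ => Finset.sum_nonneg fun j _ => hnn i j).mp h0.symm i (Finset.mem_univ i)
    have h2 := (Finset.sum_eq_zero_iff_of_nonneg fun j _ => hnn i j).mp h1 j (Finset.mem_univ j)
    exact (mul_eq_zero.mp h2).resolve_left (mul_pos (hf i) (hf j)).ne'
  have h1 := hsum fun _ => 1
  simp only [one_smul, h.sum_eq_one, hz, mul_zero, Finset.sum_const_zero, quadRep, one_mul,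
    two_smul, add_sub_cancel_right] at h1
  exact inner_self_eq_zero.mp h1

theorem SpectralDecomposition.isIdempotentDecomposition {x : E} (D : SpectralDecomposition x) :
    IsIdempotentDecomposition x D.eigenvalue D.frame where
  idem i := (D.isJordanFrame.primitive i).1
  ne_zero i := (D.isJordanFrame.primitive i).2.1
  orthogonal := D.isJordanFrame.orthogonal
  sum_eq_one := D.isJordanFrame.sum_eq_one
  eq_sum := D.eq_sum

theorem IsIdempotentDecomposition.pos_of_mem_interior (h : IsIdempotentDecomposition x l c)
    (hx : x ∈ interior (symCone E)) (i : ι) : 0 < l i := by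
  classical
  have ht : Filter.Tendsto (fun e : ℝ => x - e • (1 : E)) (nhdsWithin 0 (Set.Ioi 0))
      (nhds x) := by
    have : Continuous fun e : ℝ => x - e • (1 : E) := by fun_prop
    simpa using (this.tendsto 0).mono_left nhdsWithin_le_nhds
  -- Here `e` is a small positive real with `x - e • 1 = y * y`; pairing with `c i` yields `l i ≥
  -- e`.
  obtain ⟨e, ⟨y, hy⟩, he⟩ :=
    ((ht.eventually (mem_interior_iff_mem_nhds.mp hx)).and self_mem_nhdsWithin).exists
  have hci : 0 < inner ℝ (c i) (c i) := real_inner_self_pos.mpr (h.ne_zero i)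
  have h1 : inner ℝ x (c i) = l i * inner ℝ (c i) (c i) := by
    rw [h.eq_sum, sum_inner, Finset.sum_eq_single i]
    · rw [real_inner_smul_left]
    · intro j _ hj
      rw [real_inner_smul_left, ← inner_mul_one, h.orthogonal j i hj, inner_zero_left, mul_zero]
    · simp
  have h2 : inner ℝ (1 : E) (c i) = inner ℝ (c i) (c i) := by
    rw [← inner_mul_one (c i), (h.idem i).eq, real_inner_comm]
  have h3 := inner_idempotent_mul_self_nonneg (h.idem i) y
  rw [mul_comm, inner_lmul_left, ← hy, real_inner_comm, inner_sub_left,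
    real_inner_smul_left, h1, h2] at h3
  have he' : 0 < e := he
  by_contra hl
  nlinarith [mul_pos he' hci]

theorem IsIdempotentDecomposition.quadRep_inv_sqrt (h : IsIdempotentDecomposition x l c)
    (hpos : ∀ i, 0 < l i) : quadRep (∑ i, (Real.sqrt (l i))⁻¹ • c i) x = 1 := by
  have e1 : ∀ i, (Real.sqrt (l i))⁻¹ * ((Real.sqrt (l i))⁻¹ * l i) = 1 := fun i => by
    rw [← mul_assoc, ← mul_inv, Real.mul_self_sqrt (hpos i).le, inv_mul_cancel₀ (hpos i).ne']
  have e2 : ∀ i, (Real.sqrt (l i))⁻¹ * (Real.sqrt (l i))⁻¹ * l i = 1 := fun i => by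
    rw [mul_assoc, e1]
  rw [quadRep, h.eq_sum]
  simp only [h.sum_smul_mul_sum_smul, e1, e2, one_smul, h.sum_eq_one, two_smul,
    add_sub_cancel_right]

theorem exists_invSqrt_eq [FiniteDimensional ℝ E] (x : E) :
    ∃ D : SpectralDecomposition x,
      invSqrt x = ∑ i, (Real.sqrt (D.eigenvalue i))⁻¹ • D.frame i :=
  ⟨(nonempty_spectralDecomposition x).some, dif_pos (nonempty_spectralDecomposition x)⟩

/-- `Q_{x^{-1/2}}` maps only `x` to the identity. -/
theorem quadRep_invSqrt_eq_one_iff [FiniteDimensional ℝ E] {x : E}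
    (hx : x ∈ interior (symCone E)) (u : E) : quadRep (invSqrt x) u = 1 ↔ u = x := by
  obtain ⟨D, hD⟩ := exists_invSqrt_eq x
  have h := D.isIdempotentDecomposition
  have hpos := h.pos_of_mem_interior hx
  have hself : quadRep (invSqrt x) x = 1 := by rw [hD, h.quadRep_inv_sqrt hpos]
  refine ⟨fun hu => ?_, fun hu => hu ▸ hself⟩
  have hsub : quadRep (invSqrt x) (u - x) = 0 := by
    have : quadRep (invSqrt x) (u - x) = quadRep (invSqrt x) u - quadRep (invSqrt x) x := by
      simp only [quadRep, mul_sub, smul_sub]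
      abel
    rw [this, hu, hself, sub_self]
  rw [hD] at hsub
  exact sub_eq_zero.mp (h.eq_zero_of_quadRep_eq_zero
    (fun i => inv_pos.mpr (Real.sqrt_pos.mpr (hpos i))) hsub)

end QuadraticRepresentation

/-! ### Bounds on the determinant. -/

section Eigenvalues

variable {A : Type*} [AddCommGroup A] [Module ℝ A] [Mul A] [One A]

theorem abs_le_infNorm {x : A} {l : ℝ} (hl : l ∈ eigenvalues x) : |l| ≤ infNorm x := by
  classical
  refine le_csSup (Set.Finite.bddAbove ?_) ⟨l, hl, rfl⟩
  refine ((eigenvalues x).toFinset.finite_toSet.image abs).subset ?_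
  rintro _ ⟨k, hk, rfl⟩
  exact ⟨k, by simpa using hk, rfl⟩

/-- Supplies the upper bound without which the `sSup` in `deltaInf` would be a junk value. -/
theorem det_le_one {x : A} (hx : infNorm x = 1) : det x ≤ 1 := by
  have key : ∀ S : Multiset ℝ, (∀ l ∈ S, |l| ≤ 1) → |S.prod| ≤ 1 := by
    intro S
    induction S using Multiset.induction with
    | empty => simp
    | cons a S ih =>
      intro h
      rw [Multiset.prod_cons, abs_mul]
      exact mul_le_one₀ (h a (Multiset.mem_cons_self a S)) (abs_nonneg _)
        (ih fun l hl => h l (Multiset.mem_cons_of_mem hl))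
  exact (le_abs_self _).trans (key _ fun l hl => hx ▸ abs_le_infNorm hl)

theorem det_le_deltaInf {S : Set A} {x : A} (hx : x ∈ S) (hn : infNorm x = 1) :
    det x ≤ deltaInf S := by
  refine le_csSup ⟨1, ?_⟩ ⟨x, ⟨hx, hn⟩, rfl⟩
  rintro _ ⟨z, hz, rfl⟩
  exact det_le_one hz.2

theorem IsDeltaMaximizer.deltaInf_eq {S : Set A} {y : A} (hy : IsDeltaMaximizer S y) :
    deltaInf S = det y := by
  refine IsGreatest.csSup_eq ⟨⟨y, hy.1, rfl⟩, ?_⟩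
  rintro _ ⟨z, hz, rfl⟩
  exact hy.2 z hz.1 hz.2

theorem exists_eigenvalues_eq {x : A} (h : Nonempty (SpectralDecomposition x)) :
    ∃ D : SpectralDecomposition x,
      eigenvalues x = (Finset.univ.val : Multiset (Fin D.rank)).map D.eigenvalue :=
  ⟨h.some, dif_pos h⟩

end Eigenvalues

/-! ### Jordan frames of the product algebra and the comparison of the maxima. -/

section Product

variable {E : Type*} [NormedAddCommGroup E] [InnerProductSpace ℝ E] [EuclideanJordanAlgebra E]

theorem isIdempotentElem_prod_iff {p : E × ℝ × ℝ} : IsIdempotentElem p ↔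
    IsIdempotentElem p.1 ∧ (p.2.1 = 0 ∨ p.2.1 = 1) ∧ (p.2.2 = 0 ∨ p.2.2 = 1) := by
  rw [← IsIdempotentElem.iff_eq_zero_or_one, ← IsIdempotentElem.iff_eq_zero_or_one]
  simp only [IsIdempotentElem, Prod.ext_iff, Prod.fst_mul, Prod.snd_mul]

/-- An idempotent with nonzero components in two factors splits, so a primitive one lives in a
single factor. -/
theorem IsPrimitiveIdempotent.prod_cases {p : E × ℝ × ℝ} (hp : IsPrimitiveIdempotent p) :
    p.2 = 0 ∨ p = (0, 1, 0) ∨ p = (0, 0, 1) := by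
  obtain ⟨a, t, r⟩ := p
  obtain ⟨hi, -, hs⟩ := hp
  obtain ⟨ha, ht, hr⟩ := isIdempotentElem_prod_iff.mp hi
  simp only at ha ht hr
  have h00 : IsIdempotentElem (0 : E) := mul_zero 0
  rcases ht with rfl | rfl
  · rcases hr with rfl | rfl
    · exact Or.inl rfl
    · by_cases h : a = 0
      · exact Or.inr (Or.inr (by rw [h]))
      · refine absurd ?_ (hs (0, 0, 1) (a, 0, 0) (isIdempotentElem_prod_iff.mpr ⟨h00, by simp⟩)
          (isIdempotentElem_prod_iff.mpr ⟨ha, by simp⟩) (by simp) (by simpa using h))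
        simp
  · by_cases h : a = 0 ∧ r = 0
    · exact Or.inr (Or.inl (by rw [h.1, h.2]))
    · refine absurd ?_ (hs (0, 1, 0) (a, 0, r) (isIdempotentElem_prod_iff.mpr ⟨h00, by simp⟩)
        (isIdempotentElem_prod_iff.mpr ⟨ha, by simpa using hr⟩) (by simp) (by simpa using h))
      simp

theorem eq_zero_of_idempotent_add_eq_zero {a b : E} (ha : IsIdempotentElem a)
    (hb : IsIdempotentElem b) (h : a + b = 0) : a = 0 := by
  have h0 := mul_eq_zero_of_idempotent_add ha hb (by rw [h]; exact mul_zero 0)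
  rwa [eq_neg_of_add_eq_zero_right h, mul_neg, ha.eq, neg_eq_zero] at h0

theorem isPrimitiveIdempotent_inl {a : E} (ha : IsPrimitiveIdempotent a) :
    IsPrimitiveIdempotent ((a, 0, 0) : E × ℝ × ℝ) := by
  refine ⟨isIdempotentElem_prod_iff.mpr ⟨ha.1, by simp⟩, by simpa using ha.2.1, ?_⟩
  rintro ⟨p, t, r⟩ ⟨q, t', r'⟩ hp hq hp0 hq0 h
  obtain ⟨ip, it, ir⟩ := isIdempotentElem_prod_iff.mp hp
  obtain ⟨iq, it', ir'⟩ := isIdempotentElem_prod_iff.mp hq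
  simp only [Prod.mk_add_mk, Prod.mk.injEq] at h it ir it' ir'
  obtain ⟨h1, h2, h3⟩ := h
  have e : t = 0 ∧ t' = 0 ∧ r = 0 ∧ r' = 0 := by
    grind
  obtain ⟨rfl, rfl, rfl, rfl⟩ := e
  exact ha.2.2 p q ip iq (by simpa using hp0) (by simpa using hq0) h1

theorem isPrimitiveIdempotent_inr_inl : IsPrimitiveIdempotent ((0, 1, 0) : E × ℝ × ℝ) := by
  refine ⟨isIdempotentElem_prod_iff.mpr ⟨mul_zero 0, by simp⟩, by simp, ?_⟩
  rintro ⟨p, t, r⟩ ⟨q, t', r'⟩ hp hq hp0 hq0 h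
  obtain ⟨ip, it, ir⟩ := isIdempotentElem_prod_iff.mp hp
  obtain ⟨iq, it', ir'⟩ := isIdempotentElem_prod_iff.mp hq
  simp only [Prod.mk_add_mk, Prod.mk.injEq] at h it ir it' ir' ip iq
  obtain ⟨h1, h2, h3⟩ := h
  obtain rfl := eq_zero_of_idempotent_add_eq_zero ip iq h1.symm
  obtain rfl : q = 0 := by simpa using h1.symm
  simp only [ne_eq, Prod.mk_eq_zero, true_and] at hp0 hq0
  grind

theorem isPrimitiveIdempotent_inr_inr : IsPrimitiveIdempotent ((0, 0, 1) : E × ℝ × ℝ) := by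
  refine ⟨isIdempotentElem_prod_iff.mpr ⟨mul_zero 0, by simp⟩, by simp, ?_⟩
  rintro ⟨p, t, r⟩ ⟨q, t', r'⟩ hp hq hp0 hq0 h
  obtain ⟨ip, it, ir⟩ := isIdempotentElem_prod_iff.mp hp
  obtain ⟨iq, it', ir'⟩ := isIdempotentElem_prod_iff.mp hq
  simp only [Prod.mk_add_mk, Prod.mk.injEq] at h it ir it' ir' ip iq
  obtain ⟨h1, h2, h3⟩ := h
  obtain rfl := eq_zero_of_idempotent_add_eq_zero ip iq h1.symm
  obtain rfl : q = 0 := by simpa using h1.symm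
  simp only [ne_eq, Prod.mk_eq_zero, true_and] at hp0 hq0
  grind

theorem nonempty_spectralDecomposition_prod [FiniteDimensional ℝ E] (z : E × ℝ × ℝ) :
    Nonempty (SpectralDecomposition z) := by
  obtain ⟨u, t, r⟩ := z
  obtain ⟨D⟩ := nonempty_spectralDecomposition u
  let C : Fin (D.rank + 1 + 1) → E × ℝ × ℝ :=
    Fin.cons (0, 1, 0) (Fin.cons (0, 0, 1) fun i => (D.frame i, 0, 0))
  let l : Fin (D.rank + 1 + 1) → ℝ := Fin.cons t (Fin.cons r D.eigenvalue)
  refine ⟨⟨D.rank + 1 + 1, l, C, ⟨?_, ?_, ?_⟩, ?_⟩⟩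
  · refine Fin.cases isPrimitiveIdempotent_inr_inl (Fin.cases isPrimitiveIdempotent_inr_inr ?_)
    exact fun i => isPrimitiveIdempotent_inl (D.isJordanFrame.primitive i)
  · intro i j
    refine Fin.cases ?_ (fun i => ?_) i <;> refine Fin.cases ?_ (fun j => ?_) j
    · exact fun h => absurd rfl h
    · refine Fin.cases ?_ (fun j => ?_) j <;> simp [C]
    · refine Fin.cases ?_ (fun j => ?_) i <;> simp [C]
    · refine Fin.cases ?_ (fun i => ?_) i <;> refine Fin.cases ?_ (fun j => ?_) j
      · exact fun h => absurd rfl h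
      · simp [C]
      · simp [C]
      · intro hij
        have := D.isJordanFrame.orthogonal i j fun h => hij (h ▸ rfl)
        simpa [C] using this
  · rw [Fin.sum_univ_succ, Fin.sum_univ_succ]
    have := D.isJordanFrame.sum_eq_one
    ext <;> simp [C, Prod.fst_sum, Prod.snd_sum, this]
  · rw [Fin.sum_univ_succ, Fin.sum_univ_succ]
    have := D.eq_sum
    ext <;> simp [C, l, Prod.fst_sum, Prod.snd_sum, ← this]

/-- The eigenvalues of `(e, t, r)` are `1`, `t` and `r`, the last two being simple. -/
theorem eigenvalues_one_prod [FiniteDimensional ℝ E] [Nontrivial E] (t r : ℝ) :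
    (∀ l, l ∈ eigenvalues ((1, t, r) : E × ℝ × ℝ) ↔ l = 1 ∨ l = t ∨ l = r) ∧
      det ((1, t, r) : E × ℝ × ℝ) = t * r := by
  obtain ⟨D, hD⟩ := exists_eigenvalues_eq (nonempty_spectralDecomposition_prod
    ((1, t, r) : E × ℝ × ℝ))
  obtain ⟨hprim, horth, hone⟩ := D.isJordanFrame
  have hsum := D.eq_sum
  have hne : ∀ i j, i ≠ j → (D.frame i).1 * (D.frame j).1 = 0 ∧
      (D.frame i).2.1 * (D.frame j).2.1 = 0 ∧ (D.frame i).2.2 * (D.frame j).2.2 = 0 := by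
    intro i j hij
    have h := horth i j hij
    exact ⟨congrArg (fun z => z.1) h, congrArg (fun z => z.2.1) h, congrArg (fun z => z.2.2) h⟩
  have s1 : ∑ i, (D.frame i).1 = 1 := by
    have := congrArg Prod.fst hone; rwa [Prod.fst_sum] at this
  have s2 : ∑ i, (D.frame i).2.1 = 1 := by
    have := congrArg (fun z => z.2.1) hone; simpa [Prod.fst_sum, Prod.snd_sum] using this
  have s3 : ∑ i, (D.frame i).2.2 = 1 := by
    have := congrArg (fun z => z.2.2) hone; simpa [Prod.fst_sum, Prod.snd_sum] using this
  have e1 : ∑ i, D.eigenvalue i • (D.frame i).1 = 1 := by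
    have := congrArg Prod.fst hsum; simpa [Prod.fst_sum] using this.symm
  have e2 : ∑ i, D.eigenvalue i * (D.frame i).2.1 = t := by
    have := congrArg (fun z => z.2.1) hsum; simpa [Prod.fst_sum, Prod.snd_sum] using this.symm
  have e3 : ∑ i, D.eigenvalue i * (D.frame i).2.2 = r := by
    have := congrArg (fun z => z.2.2) hsum; simpa [Prod.fst_sum, Prod.snd_sum] using this.symm
  have hc := fun i => (hprim i).prod_cases
  obtain ⟨i₂, hi₂⟩ : ∃ i, D.frame i = (0, 1, 0) := by
    by_contra! hno
    have : ∀ i, (D.frame i).2.1 = 0 := fun i => by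
      rcases hc i with h | h | h
      · rw [h]; rfl
      · exact absurd h (hno i)
      · rw [h]
    simp [this] at s2
  obtain ⟨i₃, hi₃⟩ : ∃ i, D.frame i = (0, 0, 1) := by
    by_contra! hno
    have : ∀ i, (D.frame i).2.2 = 0 := fun i => by
      rcases hc i with h | h | h
      · rw [h]; rfl
      · rw [h]
      · exact absurd h (hno i)
    simp [this] at s3
  have h23 : i₂ ≠ i₃ := by
    rintro rfl
    simp [hi₂] at hi₃
  have l2 : D.eigenvalue i₂ = t := by
    refine Eq.trans ?_ e2
    rw [Finset.sum_eq_single i₂]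
    · simp [hi₂]
    · intro j _ hj
      have := (hne j i₂ hj).2.1
      rw [hi₂, mul_one] at this
      rw [this, mul_zero]
    · simp
  have l3 : D.eigenvalue i₃ = r := by
    refine Eq.trans ?_ e3
    rw [Finset.sum_eq_single i₃]
    · simp [hi₃]
    · intro j _ hj
      have := (hne j i₃ hj).2.2
      rw [hi₃, mul_one] at this
      rw [this, mul_zero]
    · simp
  -- Multiplying the first component of the decomposition by `(D.frame i).1` isolates the `i`-th
  -- term.
  have l1 : ∀ i, (D.frame i).1 ≠ 0 → D.eigenvalue i = 1 := by
    intro i hi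
    have h := congrArg (· * (D.frame i).1) e1
    have hid : (D.frame i).1 * (D.frame i).1 = (D.frame i).1 :=
      (isIdempotentElem_prod_iff.mp (hprim i).1).1
    simp only [Finset.sum_mul, smul_mul_assoc, one_mul] at h
    rw [Finset.sum_eq_single i (fun j _ hj => by rw [(hne j i hj).1, smul_zero]) (by simp),
      hid] at h
    have h' : (D.eigenvalue i - 1) • (D.frame i).1 = 0 := by rw [sub_smul, h, one_smul, sub_self]
    exact sub_eq_zero.mp ((smul_eq_zero.mp h').resolve_right hi)
  have hrest : ∀ i, i ≠ i₂ → i ≠ i₃ → D.eigenvalue i = 1 := by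
    intro i h2 h3
    refine l1 i fun h => (hprim i).2.1 ?_
    have a2 := (hne i i₂ h2).2.1
    have a3 := (hne i i₃ h3).2.2
    rw [hi₂, mul_one] at a2
    rw [hi₃, mul_one] at a3
    exact Prod.ext h (Prod.ext a2 a3)
  obtain ⟨i₁, hi₁⟩ : ∃ i, (D.frame i).1 ≠ 0 := by
    by_contra! hno
    simp only [hno, Finset.sum_const_zero] at s1
    obtain ⟨u, hu⟩ := exists_ne (0 : E)
    exact hu (by rw [← one_mul u, ← s1, zero_mul])
  constructor
  · intro l
    rw [hD, Multiset.mem_map]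
    constructor
    · rintro ⟨i, -, rfl⟩
      by_cases h2 : i = i₂
      · exact Or.inr (Or.inl (h2 ▸ l2))
      by_cases h3 : i = i₃
      · exact Or.inr (Or.inr (h3 ▸ l3))
      exact Or.inl (hrest i h2 h3)
    · rintro (rfl | rfl | rfl)
      · exact ⟨i₁, Finset.mem_univ_val _, l1 i₁ hi₁⟩
      · exact ⟨i₂, Finset.mem_univ_val _, l2⟩
      · exact ⟨i₃, Finset.mem_univ_val _, l3⟩
  · rw [det, hD]
    change ∏ i, D.eigenvalue i = _
    rw [Finset.prod_eq_mul i₂ i₃ h23 (fun i _ h => hrest i h.1 h.2) (by simp) (by simp), l2, l3]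

theorem infNorm_one_prod_eq_one_iff [FiniteDimensional ℝ E] [Nontrivial E] {t r : ℝ}
    (ht : 0 < t) (hr : 0 < r) :
    infNorm ((1, t, r) : E × ℝ × ℝ) = 1 ↔ t ≤ 1 ∧ r ≤ 1 := by
  have hm := (eigenvalues_one_prod (E := E) t r).1
  constructor
  · intro h
    have h1 := abs_le_infNorm ((hm t).mpr (by simp))
    have h2 := abs_le_infNorm ((hm r).mpr (by simp))
    rw [h] at h1 h2
    exact ⟨(le_abs_self t).trans h1, (le_abs_self r).trans h2⟩
  · rintro ⟨h1, h2⟩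
    refine IsGreatest.csSup_eq ⟨⟨1, (hm 1).mpr (by simp), by simp⟩, ?_⟩
    rintro _ ⟨l, hl, rfl⟩
    rcases (hm l).mp hl with rfl | rfl | rfl
    · simp
    · rwa [abs_of_pos ht]
    · rwa [abs_of_pos hr]

theorem mem_interior_symConeBar {u : E} {t r : ℝ} :
    (u, t, r) ∈ interior (symConeBar E) ↔ u ∈ interior (symCone E) ∧ 0 < t ∧ 0 < r := by
  simp only [symConeBar, interior_prod_eq, interior_Ici, Set.mem_prod, Set.mem_Ioi]

theorem quadRep_scalingPoint (x : E) (p : E × ℝ × ℝ) :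
    quadRep (scalingPoint x) p = (quadRep (invSqrt x) p.1, p.2.1, p.2.2) := by
  obtain ⟨u, t, r⟩ := p
  refine Prod.ext rfl (Prod.ext ?_ ?_)
  · change (2 : ℝ) * (1 * (1 * t)) - 1 * 1 * t = t
    ring
  · change (2 : ℝ) * (1 * (1 * r)) - 1 * 1 * r = r
    ring

variable {m : ℕ} {𝒜 : E →ₗ[ℝ] (Fin m → ℝ)} {b : Fin m → ℝ} {c : E} {θ : ℝ}

theorem one_mem_scaledSet_iff [FiniteDimensional ℝ E] {x : E}
    (hx : IsInteriorFeasible 𝒜 b x) {t r : ℝ} :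
    ((1, t, r) : E × ℝ × ℝ) ∈ scaledSet 𝒜 b c θ (scalingPoint x) ↔
      (b = t • b ∧ r = θ * t - inner ℝ c x) ∧
        (1 : E) ∈ interior (symCone E) ∧ 0 < t ∧ 0 < r := by
  rw [scaledSet, Set.mem_inter_iff, mem_interior_symConeBar]
  refine and_congr_left fun _ => ⟨?_, ?_⟩
  · rintro ⟨⟨u, t', r'⟩, hp, hq⟩
    rw [quadRep_scalingPoint] at hq
    simp only [Prod.mk.injEq] at hq
    obtain ⟨h1, rfl, rfl⟩ := hq
    obtain rfl := (quadRep_invSqrt_eq_one_iff hx.1 u).mp h1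
    obtain ⟨k1, k2⟩ := hp
    simp only [hx.2] at k1 k2
    exact ⟨sub_eq_zero.mp k1, by linarith⟩
  · rintro ⟨h1, h2⟩
    refine ⟨(x, t, r), ⟨?_, ?_⟩, ?_⟩
    · rw [hx.2]
      exact sub_eq_zero.mpr h1
    · simp only [h2]
      ring
    · rw [quadRep_scalingPoint, (quadRep_invSqrt_eq_one_iff hx.1 x).mpr rfl]

theorem deltaInf_lt_deltaInf [FiniteDimensional ℝ E] {s x : E}
    (hs : IsInteriorFeasible 𝒜 b s) (hx : IsInteriorFeasible 𝒜 b x) {y : E × ℝ × ℝ}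
    (hy : IsDeltaMaximizer (scaledSet 𝒜 b c θ (scalingPoint s)) y) (hy_fst : y.1 = 1)
    (hx_lower : θ - 1 < inner ℝ c x) (hx_upper : (inner ℝ c x : ℝ) < inner ℝ c s) :
    deltaInf (scaledSet 𝒜 b c θ (scalingPoint s))
      < deltaInf (scaledSet 𝒜 b c θ (scalingPoint x)) := by
  -- Nontriviality makes `1` an eigenvalue of `(e, t, r)`, so its norm is at least `1`.
  have : Nontrivial E := by
    refine ⟨x, s, ?_⟩
    rintro rfl
    exact lt_irrefl _ hx_upper
  obtain ⟨u, t, r⟩ := y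
  obtain rfl : u = 1 := hy_fst
  obtain ⟨⟨hb, hr⟩, h1, ht0, hr0⟩ := (one_mem_scaledSet_iff hs).mp hy.1.1
  obtain ⟨ht1, hr1⟩ := (infNorm_one_prod_eq_one_iff ht0 hr0).mp hy.1.2
  rw [hy.deltaInf_eq, (eigenvalues_one_prod t r).2]
  -- That `1` is interior to the cone (`h1`) comes from the maximizer at `s` and is reused at `x`.
  have key : ∀ t' r' : ℝ, b = t' • b → r' = θ * t' - inner ℝ c x → 0 < t' → 0 < r' → t' ≤ 1 →
      r' ≤ 1 → t * r < t' * r' → t * r < deltaInf (scaledSet 𝒜 b c θ (scalingPoint x)) := by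
    intro t' r' hb' hr' ht' hr0' ht1' hr1' hlt
    have := det_le_deltaInf ((one_mem_scaledSet_iff hx).mpr ⟨⟨hb', hr'⟩, h1, ht', hr0'⟩)
      ((infNorm_one_prod_eq_one_iff ht' hr0').mpr ⟨ht1', hr1'⟩)
    rw [(eigenvalues_one_prod t' r').2] at this
    exact hlt.trans_le this
  have hlt : r < θ * t - inner ℝ c x := by linarith
  by_cases hcase : θ * t - inner ℝ c x ≤ 1
  · exact key t _ hb rfl ht0 (hr0.trans hlt) ht1 hcase (mul_lt_mul_of_pos_left hlt ht0)
  · push Not at hcase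
    have htne : t < 1 := by
      refine lt_of_le_of_ne ht1 ?_
      rintro rfl
      linarith
    have hb0 : b = 0 := by
      have h : (t - 1) • b = 0 := by rw [sub_smul, ← hb, one_smul, sub_self]
      exact (smul_eq_zero.mp h).resolve_left (by linarith)
    -- From `θ t > 1 + ⟪c, x⟫ > θ` and `t < 1`.
    have hθ : θ < 0 := by nlinarith
    have hmul : θ * ((1 + inner ℝ c x) / θ) = 1 + inner ℝ c x := mul_div_cancel₀ _ hθ.ne
    have hlo : t < (1 + inner ℝ c x) / θ := by
      rw [lt_div_iff_of_neg hθ]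
      linarith
    have hhi : (1 + inner ℝ c x) / θ ≤ 1 := by
      rw [div_le_iff_of_neg hθ]
      linarith
    -- This `t'` solves `θ t' - ⟪c, x⟫ = 1`; the product improves because `t' > t` and `r ≤ 1`.
    refine key ((1 + inner ℝ c x) / θ) 1 (by simp [hb0]) (by linarith) (ht0.trans hlo) one_pos hhi
      le_rfl ?_
    nlinarith

end Product

end JordanSCP

theorem mainTheorem10 {E : Type*} [NormedAddCommGroup E] [InnerProductSpace ℝ E]
    [FiniteDimensional ℝ E] [EuclideanJordanAlgebra E] {m : ℕ}
    (𝒜 : E →ₗ[ℝ] (Fin m → ℝ)) (b : Fin m → ℝ) (c : E) (θ : ℝ)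
    (hP : JordanSCP.StronglyFeasible 𝒜 b)
    (s : E) (hs : JordanSCP.IsInteriorFeasible 𝒜 b s)
    (hs_lower : max (JordanSCP.primalValue 𝒜 b c) ((θ - 1 : ℝ) : EReal)
      < ((inner ℝ c s : ℝ) : EReal))
    (hs_upper : inner ℝ c s < θ)
    (y : E × ℝ × ℝ)
    (hy : JordanSCP.IsDeltaMaximizer
      (JordanSCP.scaledSet 𝒜 b c θ (JordanSCP.scalingPoint s)) y)
    (hy_fst : y.1 = 1)
    (x : E) (hx : JordanSCP.IsInteriorFeasible 𝒜 b x)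
    (hx_lower : max (JordanSCP.primalValue 𝒜 b c) ((θ - 1 : ℝ) : EReal)
      < ((inner ℝ c x : ℝ) : EReal))
    (hx_upper : (inner ℝ c x : ℝ) < inner ℝ c s) :
    JordanSCP.deltaInf (JordanSCP.scaledSet 𝒜 b c θ (JordanSCP.scalingPoint s))
      < JordanSCP.deltaInf (JordanSCP.scaledSet 𝒜 b c θ (JordanSCP.scalingPoint x)) := by
  exact JordanSCP.deltaInf_lt_deltaInf hs hx hy hy_fst
    (EReal.coe_lt_coe_iff.mp ((le_max_right _ _).trans_lt hx_lower)) hx_upper
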